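/- **Setting.** Let $G=(V,E)$ be a directed graph (parallel edges allowed) and $I$ a finite set of commodities. Each commodity $i\in I$ has an origin and a destination vertex, a demand $Q_i\ge 0$, and a finite nonempty set $\mathcal P_i$ of directed simple paths from its origin to its destination (for instance all of them). A path is identified with its set of edges when we write $e\in p$, $p\cap q$, $q\setminus p$. Let $$\mathcal F_Q=\Bigl\{f=(f_{i,p})_{i\in I,\,p\in\mathcal P_i}\ :\ f_{i,p}\ge 0,\ \sum_{p\in\mathcal P_i}f_{i,p}=Q_i\ \text{for all } i\in I\Bigr\}$$ be the set of demand-feasible path flows. For $f\in\mathcal F_Q$, $p,q\in\mathcal P_i$ and $0<\varepsilon\le f_{i,p}$ let $f_{i,p\to q}(\varepsilon)=f+\varepsilon(1_{i,q}-1_{i,p})\in\mathcal F_Q$. A cost structure is a map $c:\mathcal F_Q\to\mathbb R_{\ge 0}^{I\times E}$, $f\mapsto (c_{i,e}(f))_{i\in I,e\in E}$; the cost of a path $p\in\mathcal P_i$ is $c_{i,p}(f)=\sum_{e\in p}c_{i,e}(f)$. The upper hull of $c_{i,e}$ is $$\bar c_{i,e}(f)=\lim_{\varepsilon\downarrow 0}\sup\{c_{i,e}(x)\mid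 x\in\mathcal F_Q,\ \|x-f\|<\varepsilon\}.$$ The cost structure $c$ is called *weakly regular* if for all $f\in\mathcal F_Q$, $i\in I$ and $p\in\mathcal P_i$ with $f_{i,p}>0$, $$c_{i,p}(f)\le\min_{q\in\mathcal P_i}\Bigl(\sum_{e\in p\cap q}c_{i,e}(f)+\sum_{e\in q\setminus p}\bar c_{i,e}(f)\Bigr)\ \Longrightarrow\ c_{i,p}(f)\le\min_{q\in\mathcal P_i}\liminf_{\varepsilon\downarrow 0}c_{i,q}(f_{i,p\to q}(\varepsilon)).$$ A flow $f\in\mathcal F_Q$ is a *Bernstein–Smith equilibrium* (BS-equilibrium) if for all $i\in I$, all $p\in\mathcal P_i$ with $f_{i,p}>0$ and all $q\in\mathcal P_i$, $$c_{i,p}(f)\le\liminf_{\varepsilon\downarrow 0}c_{i,q}(f_{i,p\to q}(\varepsilon)).$$ **Theorem.** If $c:\mathcal F_Q\to\mathbb R_{\ge 0}^{I\times E}$ is bounded (there is $M$ with $c_{i,e}(f)\le M$ for all $i,e,f$), weakly regular, and every $c_{i,e}$ is lower semicontinuous on $\mathcal F_Q$, then a BS-equilibrium exists. -/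

import Mathlib

open scoped NNReal ENNReal Topology

/-- A directed multigraph with vertex type `V` and edge type `E`. -/
structure DiMultigraph (V E : Type*) where
  tail : E → V
  head : E → V

namespace DiMultigraph

variable {V E : Type*} (G : DiMultigraph V E)

/-- The list of edges `es` is a directed walk from `u` to `w`. -/
def IsWalk : V → V → List E → Prop
  | u, w, [] => u = w
  | u, w, e :: es => G.tail e = u ∧ IsWalk (G.head e) w es

/-- The list of edges `es` is a directed simple path from `u` to `w`:
a walk that visits no vertex twice. -/
def IsPath (u w : V) (es : List E) : Prop :=
  G.IsWalk u w es ∧ (u :: es.map G.head).Nodup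

end DiMultigraph

/-- A multi-commodity routing network: a directed graph and, for every commodity `i`, an origin,
a destination, a demand `Q i ≥ 0`, and a finite nonempty set `P i` of paths from the origin to the
destination (the strategies of the commodity, e.g. all such paths), given by their edge lists. -/
structure RoutingNetwork (V E I : Type*) where
  graph : DiMultigraph V E
  source : I → V
  sink : I → V
  Q : I → ℝ≥0
  P : I → Finset (List E)
  nonempty_P : ∀ i, (P i).Nonempty
  isPath_of_mem : ∀ i, ∀ p ∈ P i, graph.IsPath (source i) (sink i) p

namespace RoutingNetwork

variable {V E I : Type*} [DecidableEq E] [DecidableEq I]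
variable (N : RoutingNetwork V E I)

/-- The commodity-path pairs `(i, p)` with `p ∈ P i`. -/
abbrev Pairs : Type _ := Σ i : I, {p : List E // p ∈ N.P i}

/-- The demand-feasible path flows. -/
def demandFeasible : Set (N.Pairs → ℝ) :=
  {f | (∀ x, 0 ≤ f x) ∧ ∀ i, ∑ p : {p : List E // p ∈ N.P i}, f ⟨i, p⟩ = N.Q i}

/-- The vector `f + ε (1_{i,q} - 1_{i,p})`. -/
def shift (f : N.Pairs → ℝ) (i : I) (p q : {p : List E // p ∈ N.P i}) (ε : ℝ) : N.Pairs → ℝ :=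
  f + ε • (Pi.single (⟨i, q⟩ : N.Pairs) (1 : ℝ) - Pi.single (⟨i, p⟩ : N.Pairs) (1 : ℝ))

theorem shift_mem {f : N.Pairs → ℝ} (hf : f ∈ N.demandFeasible) (i : I)
    (p q : {p : List E // p ∈ N.P i}) {ε : ℝ} (h0 : 0 ≤ ε) (h1 : ε ≤ f ⟨i, p⟩) :
    N.shift f i p q ε ∈ N.demandFeasible := by
  refine ⟨fun x => ?_, fun j => ?_⟩
  · have hx := hf.1 x
    have hq : (0 : ℝ) ≤ Pi.single (M := fun _ : N.Pairs => ℝ) ⟨i, q⟩ 1 x := by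
      by_cases h : x = ⟨i, q⟩
      · subst h; simp
      · simp [Pi.single_eq_of_ne h]
    simp only [shift, Pi.add_apply, Pi.smul_apply, Pi.sub_apply, smul_eq_mul]
    by_cases h : x = ⟨i, p⟩
    · subst h
      simp only [Pi.single_eq_same]
      nlinarith [mul_nonneg h0 hq]
    · simp only [Pi.single_eq_of_ne h]
      nlinarith [mul_nonneg h0 hq]
  · have key : ∀ r : {p : List E // p ∈ N.P i},
        ∑ s : {p : List E // p ∈ N.P j},
          Pi.single (M := fun _ : N.Pairs => ℝ) ⟨i, r⟩ (1 : ℝ) ⟨j, s⟩ = if j = i then 1 else 0 := by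
      intro r
      by_cases h : j = i
      · subst h
        simp [Pi.single_apply]
      · rw [if_neg h]
        refine Finset.sum_eq_zero fun s _ => Pi.single_eq_of_ne ?_ _
        intro h'
        exact h (congrArg Sigma.fst h')
    simp only [shift, Pi.add_apply, Pi.smul_apply, Pi.sub_apply, smul_eq_mul,
      Finset.sum_add_distrib, ← Finset.mul_sum, Finset.sum_sub_distrib, key]
    rw [hf.2 j]
    ring

/-- The `ε`-deviation `f_{i,p→q}(ε)`, a demand-feasible flow for `0 < ε ≤ f_{i,p}`. -/
def deviation (f : N.demandFeasible) (i : I) (p q : {p : List E // p ∈ N.P i})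
    (ε : Set.Ioc (0 : ℝ) (f.1 ⟨i, p⟩)) : N.demandFeasible :=
  ⟨N.shift f.1 i p q ε, N.shift_mem f.2 i p q ε.2.1.le ε.2.2⟩

/-- A cost structure assigns to every demand-feasible flow, commodity and edge a cost in `[0,∞)`. -/
abbrev CostStructure : Type _ := N.demandFeasible → I → E → ℝ≥0

variable [Fintype I] {N}

namespace CostStructure

variable (c : N.CostStructure)

/-- `c_{i,p}(f) = ∑_{e ∈ p} c_{i,e}(f)`. -/
def pathCost (i : I) (p : {p : List E // p ∈ N.P i}) (f : N.demandFeasible) : ℝ≥0 :=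
  ∑ e ∈ p.1.toFinset, c f i e

/-- The upper hull of `c_{i,e}` at `f`: the limit as `ε ↓ 0` (an infimum, by monotonicity) of the
suprema of `c_{i,e}` over the `ε`-balls around `f` in the set of demand-feasible flows. -/
noncomputable def upperHull (i : I) (e : E) (f : N.demandFeasible) : ℝ≥0∞ :=
  ⨅ (ε : ℝ) (_ : 0 < ε), ⨆ x ∈ Metric.ball f ε, (c x i e : ℝ≥0∞)

/-- `∑_{e ∈ p ∩ q} c_{i,e}(f) + ∑_{e ∈ q \ p} c̄_{i,e}(f)`. -/
noncomputable def hullCost (i : I) (p q : {p : List E // p ∈ N.P i}) (f : N.demandFeasible) :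
    ℝ≥0∞ :=
  ∑ e ∈ p.1.toFinset ∩ q.1.toFinset, (c f i e : ℝ≥0∞) +
    ∑ e ∈ q.1.toFinset \ p.1.toFinset, c.upperHull i e f

/-- `liminf_{ε ↓ 0} c_{i,q}(f_{i,p→q}(ε))`, where `ε` ranges over `(0, f_{i,p}]`. -/
noncomputable def deviationCost (i : I) (p q : {p : List E // p ∈ N.P i})
    (f : N.demandFeasible) : ℝ≥0∞ :=
  Filter.liminf (fun ε : Set.Ioc (0 : ℝ) (f.1 ⟨i, p⟩) =>
      (c.pathCost i q (N.deviation f i p q ε) : ℝ≥0∞))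
    (Filter.comap Subtype.val (𝓝[>] (0 : ℝ)))

/-- Every `c_{i,e}` is lower semicontinuous on the set of demand-feasible flows. -/
def IsLowerSemicontinuous : Prop :=
  ∀ i e, LowerSemicontinuous fun f : N.demandFeasible => c f i e

/-- The functions `c_{i,e}` are bounded. -/
def IsBounded : Prop :=
  ∃ M : ℝ≥0, ∀ f i e, c f i e ≤ M

/-- Weak regularity of a cost structure. The infima are minima over the finite nonempty set `P i`. -/
def WeaklyRegular : Prop :=
  ∀ (f : N.demandFeasible) (i : I) (p : {p : List E // p ∈ N.P i}), 0 < f.1 ⟨i, p⟩ →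
    (c.pathCost i p f : ℝ≥0∞) ≤ (⨅ q : {p : List E // p ∈ N.P i}, c.hullCost i p q f) →
    (c.pathCost i p f : ℝ≥0∞) ≤ ⨅ q : {p : List E // p ∈ N.P i}, c.deviationCost i p q f

/-- `f` is an equilibrium in the sense of Bernstein and Smith. -/
def IsBSEquilibrium (f : N.demandFeasible) : Prop :=
  ∀ (i : I) (p : {p : List E // p ∈ N.P i}), 0 < f.1 ⟨i, p⟩ →
    ∀ q : {p : List E // p ∈ N.P i}, (c.pathCost i p f : ℝ≥0∞) ≤ c.deviationCost i p q f

end CostStructure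

end RoutingNetwork

/-!
Call a path of commodity `i` supported at a flow `f` if `f` is a limit of flows in which this path
is a cheapest one for `i`. The flows at which a given path is supported form a closed set, and at
every flow each commodity has a supported path. A covering theorem of
Knaster–Kuratowski–Mazurkiewicz type for products of simplices then yields a flow at which every
used path is supported. Comparing a supported path `p` with a path `q`, the edges of `p ∩ q`
cancel, and in the limit lower semicontinuity on `p \ q` and the upper hull on `q \ p` give the
premise of weak regularity, whose conclusion is the equilibrium condition.

For the covering theorem on one simplex, colour the points of a fine finite net by the sets that
contain them and regard the coordinates as utilities. Scarf's pivoting argument finds points of the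
net, together with slack points that stand for the absent colours, which carry all colours and which
no point of the net beats in every remaining coordinate. As the net is fine, such points lie in a
small corner `{x | m ≤ x}` of the simplex with `m i = 0` for the absent colours `i`, and they
accumulate at a point as desired. A product of simplices is reached from the simplex over the
product of the vertex sets by taking marginals.
-/

open Finset

section Counting

variable {α β : Type*} [DecidableEq α] [DecidableEq β]

theorem card_filter_image_erase_eq_two {f : α → β} {s : Finset α} {t : Finset β}
    (himage : s.image f = t) (hcard : #s = #t + 1) :
    #{x ∈ s | (s.erase x).image f = t} = 2 := by
  obtain ⟨x, hx, y, hy, hxy, hf⟩ := exists_ne_map_eq_of_card_lt_of_maps_to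
    (by omega : #t < #s) fun z hz ↦ himage ▸ mem_image_of_mem f hz
  have image_erase {a b : α} (hb : b ∈ s) (hab : a ≠ b) (hfab : f a = f b) :
      (s.erase a).image f = t := by
    refine himage ▸ (image_subset_image (erase_subset a s)).antisymm ?_
    refine image_subset_iff.2 fun w hw ↦ ?_
    rcases eq_or_ne w a with rfl | hwa
    · exact hfab ▸ mem_image_of_mem f (mem_erase.2 ⟨hab.symm, hb⟩)
    · exact mem_image_of_mem f (mem_erase.2 ⟨hwa, hw⟩)
  refine card_eq_two.2 ⟨x, y, hxy, ?_⟩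
  ext z
  simp only [mem_filter, mem_insert, mem_singleton]
  constructor
  · rintro ⟨hz, hzt⟩
    have hinj : Set.InjOn f (s.erase z) :=
      injOn_of_card_image_eq (by rw [hzt, card_erase_of_mem hz]; omega)
    by_contra! hne
    exact hxy (hinj (mem_erase.2 ⟨hne.1.symm, hx⟩) (mem_erase.2 ⟨hne.2.symm, hy⟩) hf)
  · rintro (rfl | rfl)
    · exact ⟨hx, image_erase hy hxy hf⟩
    · exact ⟨hy, image_erase hx hxy.symm hf.symm⟩

theorem even_card_filter_image_erase [Fintype β] {f : α → β} {s : Finset α}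
    (hcard : #s = Fintype.card β) (hne : s.image f ≠ univ) (b : β) :
    Even #{x ∈ s | (s.erase x).image f = univ.erase b} := by
  by_cases himage : s.image f = univ.erase b
  · rw [card_filter_image_erase_eq_two himage
      (by rw [card_erase_add_one (mem_univ b), card_univ, hcard])]
    exact even_two
  · rw [filter_false_of_mem, card_empty]
    · exact Even.zero
    intro x _ hx
    have hsub : univ.erase b ⊆ s.image f := hx ▸ image_subset_image (erase_subset x s)
    have hb : b ∉ s.image f := fun hb ↦ hne (eq_univ_iff_forall.2 fun j ↦
      (eq_or_ne j b).elim (· ▸ hb) fun hj ↦ hsub (mem_erase.2 ⟨hj, mem_univ j⟩))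
    exact himage (Subset.antisymm
      (fun j hj ↦ mem_erase.2 ⟨ne_of_mem_of_not_mem hj hb, mem_univ j⟩) hsub)

theorem sum_card_insert_mem_eq_sum_card_erase_mem [Fintype α] (𝒟 ℛ : Finset (Finset α)) :
    ∑ τ ∈ 𝒟, #{y | y ∉ τ ∧ insert y τ ∈ ℛ} = ∑ σ ∈ ℛ, #{x ∈ σ | σ.erase x ∈ 𝒟} := by
  rw [← card_sigma, ← card_sigma]
  refine card_bij' (fun z _ ↦ ⟨insert z.2 z.1, z.2⟩) (fun z _ ↦ ⟨z.1.erase z.2, z.2⟩) ?_ ?_ ?_ ?_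
  all_goals
    rintro ⟨τ, y⟩ h
    simp only [mem_sigma, mem_filter, mem_univ, true_and] at h
    simp [h, insert_erase]

theorem exists_odd_card_erase_mem [Fintype α] {𝒟 ℛ : Finset (Finset α)} {τ₀ : Finset α}
    (hτ₀ : τ₀ ∈ 𝒟) (hodd : Odd #{y | y ∉ τ₀ ∧ insert y τ₀ ∈ ℛ})
    (heven : ∀ τ ∈ 𝒟.erase τ₀, Even #{y | y ∉ τ ∧ insert y τ ∈ ℛ}) :
    ∃ σ ∈ ℛ, Odd #{x ∈ σ | σ.erase x ∈ 𝒟} := by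
  by_contra! h
  have heven_sum : Even (∑ σ ∈ ℛ, #{x ∈ σ | σ.erase x ∈ 𝒟}) :=
    even_sum _ fun σ hσ ↦ Nat.not_odd_iff_even.1 (h σ hσ)
  rw [← sum_card_insert_mem_eq_sum_card_erase_mem, ← add_sum_erase 𝒟 _ hτ₀] at heven_sum
  exact Nat.not_even_iff_odd.2 (hodd.add_even (even_sum _ heven)) heven_sum

end Counting

section Dominating

variable {J S α : Type*} [LinearOrder α] {u : J → S → α} {σ τ : Finset S} {k l : J} {y z : S}

/-- Scarf's dominating sets for a family of utility functions: no point of the ground set is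
strictly better than the worst point of `σ` for every utility at once. Points of the ground set
outside `σ` are quantified over as well, and ties count in favour of `σ`. -/
def IsDominating (u : J → S → α) (σ : Finset S) : Prop :=
  ∀ y, ∃ i, ∀ x ∈ σ, u i y ≤ u i x

/-- `y` is best for the utility `u k` among the points that are strictly better than the worst point
of `τ` for all the other utilities. These are the candidates for extending a dominating set `τ`. -/
def IsExtremal (u : J → S → α) (τ : Finset S) (k : J) (y : S) : Prop :=
  (∀ l ≠ k, ∃ x ∈ τ, u l x < u l y) ∧
    ∀ z, (∀ l ≠ k, ∃ x ∈ τ, u l x < u l z) → u k z ≤ u k y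

theorem IsDominating.mono (hσ : IsDominating u σ) (h : τ ⊆ σ) : IsDominating u τ := fun y ↦
  (hσ y).imp fun _ hi x hx ↦ hi x (h hx)

theorem exists_isExtremal [Finite S] (h : ∃ z, ∀ l ≠ k, ∃ x ∈ τ, u l x < u l z) :
    ∃ y, IsExtremal u τ k y :=
  Set.exists_max_image {z | ∀ l ≠ k, ∃ x ∈ τ, u l x < u l z} (u k) (Set.toFinite _) h

theorem IsExtremal.unique (hu : Function.Injective (u k)) (hy : IsExtremal u τ k y)
    (hz : IsExtremal u τ k z) : y = z :=
  hu (le_antisymm (hz.2 y hy.1) (hy.2 z hz.1))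

theorem IsDominating.le_of_isExtremal (hτ : IsDominating u τ) (hy : IsExtremal u τ k y) :
    ∀ x ∈ τ, u k y ≤ u k x := by
  obtain ⟨l, hl⟩ := hτ y
  rcases eq_or_ne l k with rfl | hlk
  · exact hl
  · obtain ⟨x, hx, hxy⟩ := hy.1 l hlk
    exact absurd (hl x hx) hxy.not_ge

theorem IsDominating.index_unique_of_isExtremal (hτ : IsDominating u τ)
    (hk : IsExtremal u τ k y) (hl : IsExtremal u τ l y) : k = l := by
  by_contra hkl
  obtain ⟨x, hx, hxy⟩ := hl.1 k hkl
  exact (hτ.le_of_isExtremal hk x hx).not_gt hxy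

theorem IsDominating.insert_of_isExtremal [DecidableEq S] (hτ : IsDominating u τ)
    (hy : IsExtremal u τ k y) : IsDominating u (insert y τ) := by
  intro z
  by_contra! hz
  have hzk : u k z ≤ u k y := by
    refine hy.2 z fun l hl ↦ ?_
    obtain ⟨x, hx, hxz⟩ := hz l
    rcases mem_insert.1 hx with rfl | hx
    · obtain ⟨w, hw, hwx⟩ := hy.1 l hl
      exact ⟨w, hw, hwx.trans hxz⟩
    · exact ⟨x, hx, hxz⟩
  obtain ⟨x, hx, hxz⟩ := hz k
  rcases mem_insert.1 hx with rfl | hx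
  · exact hzk.not_gt hxz
  · exact (hzk.trans (hτ.le_of_isExtremal hy x hx)).not_gt hxz

section Exchange

variable [Fintype J] [DecidableEq S] {μ : J → S}

theorem IsDominating.image_minimizer (hu : ∀ i, Function.Injective (u i))
    (hτ : IsDominating u τ) (hμ : ∀ i, μ i ∈ τ ∧ ∀ x ∈ τ, u i (μ i) ≤ u i x) :
    univ.image μ = τ := by
  refine Subset.antisymm (image_subset_iff.2 fun i _ ↦ (hμ i).1) fun x hx ↦ ?_
  obtain ⟨i, hi⟩ := hτ x
  exact mem_image.2 ⟨i, mem_univ i, hu i (le_antisymm ((hμ i).2 x hx) (hi _ (hμ i).1))⟩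

theorem IsDominating.exists_isExtremal_of_insert [DecidableEq J]
    (hu : ∀ i, Function.Injective (u i)) (hμ : ∀ i, μ i ∈ τ ∧ ∀ x ∈ τ, u i (μ i) ≤ u i x)
    (hcard : #τ + 1 = Fintype.card J) (hy : y ∉ τ) (hdom : IsDominating u (insert y τ)) :
    ∃ k, IsExtremal u τ k y ∧ (univ.erase k).image μ = τ := by
  obtain ⟨k, hk⟩ := hdom y
  have exists_minimizer : ∀ x ∈ τ, ∃ m ≠ k, μ m = x ∧ u m x < u m y := by
    intro x hx
    obtain ⟨m, hm⟩ := hdom x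
    have hlt : u m x < u m y :=
      (hm y (mem_insert_self y τ)).lt_of_ne fun h ↦ hy (hu m h ▸ hx)
    refine ⟨m, ?_, hu m (le_antisymm ((hμ m).2 x hx) (hm _ (mem_insert_of_mem (hμ m).1))), hlt⟩
    rintro rfl
    exact (hk x (mem_insert_of_mem hx)).not_gt hlt
  have himage : (univ.erase k).image μ = τ := by
    refine Subset.antisymm (image_subset_iff.2 fun m _ ↦ (hμ m).1) fun x hx ↦ ?_
    obtain ⟨m, hmk, hmx, -⟩ := exists_minimizer x hx
    exact mem_image.2 ⟨m, mem_erase.2 ⟨hmk, mem_univ m⟩, hmx⟩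
  have hinj : Set.InjOn μ (univ.erase k) := injOn_of_card_image_eq <| by
    rw [himage, card_erase_of_mem (mem_univ k), card_univ]
    omega
  refine ⟨k, ⟨fun l hl ↦ ?_, fun z hz ↦ ?_⟩, himage⟩
  · obtain ⟨m, hmk, hml, hlt⟩ := exists_minimizer (μ l) (hμ l).1
    obtain rfl : m = l := hinj (by simpa using hmk) (by simpa using hl) hml
    exact ⟨μ m, (hμ m).1, hlt⟩
  · obtain ⟨l, hl⟩ := hdom z
    rcases eq_or_ne l k with rfl | hlk
    · exact hl y (mem_insert_self y τ)
    · obtain ⟨x, hx, hxz⟩ := hz l hlk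
      exact absurd (hl x (mem_insert_of_mem hx)) hxz.not_ge

open scoped Classical in
theorem IsDominating.card_extensions_eq_two [Fintype S] (hu : ∀ i, Function.Injective (u i))
    (hτ : IsDominating u τ) (hne : τ.Nonempty) (hcard : #τ + 1 = Fintype.card J)
    (hroom : ∀ k, ∃ z, ∀ l ≠ k, ∃ x ∈ τ, u l x < u l z) :
    #{y | y ∉ τ ∧ IsDominating u (insert y τ)} = 2 := by
  choose μ hμ using fun i ↦ τ.exists_min_image (u i) hne
  choose Y hY using fun k ↦ exists_isExtremal (hroom k)
  have hYinj : Function.Injective Y := fun k l h ↦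
    hτ.index_unique_of_isExtremal (hY k) (h ▸ hY l)
  have hext : ({y | y ∉ τ ∧ IsDominating u (insert y τ)} : Finset S) =
      ({k | (univ.erase k).image μ = τ} : Finset J).image Y := by
    ext y
    simp only [mem_filter, mem_univ, true_and, mem_image]
    constructor
    · rintro ⟨hy, hdom⟩
      obtain ⟨k, hk, himage⟩ := hdom.exists_isExtremal_of_insert hu hμ hcard hy
      exact ⟨k, himage, (hY k).unique (hu k) hk⟩
    · rintro ⟨k, himage, rfl⟩
      refine ⟨fun hmem ↦ ?_, hτ.insert_of_isExtremal (hY k)⟩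
      rw [← himage] at hmem
      obtain ⟨l, hl, hlY⟩ := mem_image.1 hmem
      obtain ⟨x, hx, hxY⟩ := (hY k).1 l (ne_of_mem_erase hl)
      exact ((hμ l).2 x hx).not_gt (hlY ▸ hxY)
  rw [hext, card_image_of_injective _ hYinj]
  exact card_filter_image_erase_eq_two (hτ.image_minimizer hu hμ) (by rw [card_univ, hcard])

end Exchange

end Dominating

section Scarf

variable {J T α : Type*} [LinearOrder α]

section Slack

variable [Fintype J] [DecidableEq J] {u : J → T ⊕ J → α}

theorem isDominating_insert_slack [DecidableEq T] {a : J} {t₀ : T}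
    (hmin : ∀ i t, u i (.inr i) < u i (.inl t))
    (hmax : ∀ i, ∀ j ≠ i, ∀ t, u i (.inl t) < u i (.inr j))
    (ht₀ : ∀ t, u a (.inl t) ≤ u a (.inl t₀)) :
    IsDominating u (insert (.inl t₀) (disjSum ∅ (univ.erase a))) := by
  rintro (t | j)
  · refine ⟨a, fun x hx ↦ ?_⟩
    rcases x with s | j
    · obtain rfl : s = t₀ := by simpa using hx
      exact ht₀ t
    · exact (hmax a j (by simpa using hx) t).le
  · refine ⟨j, fun x _ ↦ ?_⟩
    rcases x with s | i
    · exact (hmin j s).le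
    · rcases eq_or_ne i j with rfl | hij
      · exact le_rfl
      · exact ((hmin j t₀).trans (hmax j i hij t₀)).le

theorem isDominating_slack [Finite T] [Nonempty T] {a : J}
    (hmin : ∀ i t, u i (.inr i) < u i (.inl t))
    (hmax : ∀ i, ∀ j ≠ i, ∀ t, u i (.inl t) < u i (.inr j)) :
    IsDominating u (disjSum ∅ (univ.erase a)) := by
  classical
  obtain ⟨t₀, ht₀⟩ := Finite.exists_max fun t ↦ u a (.inl t)
  exact (isDominating_insert_slack hmin hmax ht₀).mono (subset_insert _ _)

theorem eq_of_isDominating_insert_slack [DecidableEq T] {a : J} {t₀ : T} {y : T ⊕ J}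
    (hu : Function.Injective (u a)) (hmin : ∀ i t, u i (.inr i) < u i (.inl t))
    (ht₀ : ∀ t, u a (.inl t) ≤ u a (.inl t₀)) (hy : y ∉ disjSum ∅ (univ.erase a))
    (hdom : IsDominating u (insert y (disjSum ∅ (univ.erase a)))) : y = .inl t₀ := by
  obtain ⟨i, hi⟩ := hdom (.inl t₀)
  obtain rfl : i = a := by
    by_contra hia
    exact (hi (.inr i) (by simp [hia])).not_gt (hmin i t₀)
  have hle := hi y (mem_insert_self _ _)
  rcases y with t | j
  · exact hu (le_antisymm (ht₀ t) hle)
  · obtain rfl : j = i := by simpa using hy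
    exact absurd hle (hmin j t₀).not_ge

theorem exists_inl_mem_of_image_eq_erase {color : T ⊕ J → J} {a : J} {τ : Finset (T ⊕ J)}
    (hcolor : ∀ j, color (.inr j) = j) (hcard : #τ + 1 = Fintype.card J)
    (himage : τ.image color = univ.erase a) (hne : τ ≠ disjSum ∅ (univ.erase a)) :
    ∃ t, Sum.inl t ∈ τ := by
  by_contra! hinl
  refine hne (eq_of_subset_of_card_le ?_ ?_)
  · rintro (t | j) hx
    · exact absurd hx (hinl t)
    · have hj := mem_image_of_mem color hx
      rw [himage, hcolor] at hj
      exact inr_mem_disjSum.2 hj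
  · rw [card_disjSum, card_empty, card_erase_of_mem (mem_univ a), card_univ]
    omega

open scoped Classical in
theorem card_extensions_slack_eq_one [Fintype T] [Nonempty T] {a : J}
    (hu : Function.Injective (u a)) (hmin : ∀ i t, u i (.inr i) < u i (.inl t))
    (hmax : ∀ i, ∀ j ≠ i, ∀ t, u i (.inl t) < u i (.inr j)) :
    #{y | y ∉ disjSum ∅ (univ.erase a) ∧
      IsDominating u (insert y (disjSum ∅ (univ.erase a)))} = 1 := by
  obtain ⟨t₀, ht₀⟩ := Finite.exists_max fun t ↦ u a (.inl t)
  refine card_eq_one.2 ⟨.inl t₀, eq_singleton_iff_unique_mem.2 ⟨?_, fun y hy ↦ ?_⟩⟩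
  · exact mem_filter_univ _ |>.2 ⟨by simp, isDominating_insert_slack hmin hmax ht₀⟩
  · obtain ⟨hy, hdom⟩ := mem_filter_univ _ |>.1 hy
    exact eq_of_isDominating_insert_slack hu hmin ht₀ hy hdom

theorem exists_isDominating_image_eq_univ [Finite T] [Nonempty J] [Nonempty T]
    (hu : ∀ i, Function.Injective (u i)) (hmin : ∀ i t, u i (.inr i) < u i (.inl t))
    (hmax : ∀ i, ∀ j ≠ i, ∀ t, u i (.inl t) < u i (.inr j)) {color : T ⊕ J → J}
    (hcolor : ∀ j, color (.inr j) = j) :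
    ∃ σ : Finset (T ⊕ J), IsDominating u σ ∧ σ.image color = univ := by
  classical
  have := Fintype.ofFinite T
  obtain ⟨a⟩ := ‹Nonempty J›
  -- Count the pairs `τ ⊂ σ` of dominating sets, `#τ + 1 = #σ = #J`, where `τ` has all the colours
  -- but `a`. Every such `τ` lies in two such `σ`, except for `τ₀`, which lies in just one, whereas
  -- a `σ` that misses a colour contains an even number of such `τ`.
  let τ₀ : Finset (T ⊕ J) := disjSum ∅ (univ.erase a)
  let 𝒟 : Finset (Finset (T ⊕ J)) :=
    {τ | IsDominating u τ ∧ #τ + 1 = Fintype.card J ∧ τ.image color = univ.erase a}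
  let ℛ : Finset (Finset (T ⊕ J)) := {σ | IsDominating u σ ∧ #σ = Fintype.card J}
  have erase_mem_𝒟 {σ x} (hσ : σ ∈ ℛ) (hx : x ∈ σ) :
      σ.erase x ∈ 𝒟 ↔ (σ.erase x).image color = univ.erase a := by
    obtain ⟨hdom, hcard⟩ := mem_filter_univ _ |>.1 hσ
    simp [𝒟, hdom.mono (erase_subset x σ), card_erase_add_one hx, hcard]
  have card_insert_mem {τ} (hτ : τ ∈ 𝒟) : #{y | y ∉ τ ∧ insert y τ ∈ ℛ} =
      #{y | y ∉ τ ∧ IsDominating u (insert y τ)} := by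
    refine congrArg card (filter_congr fun y _ ↦ and_congr_right fun hy ↦ ?_)
    simp [ℛ, card_insert_of_notMem hy, (mem_filter_univ _ |>.1 hτ).2.1]
  have hτ₀ : τ₀ ∈ 𝒟 := by
    refine mem_filter_univ _ |>.2 ⟨isDominating_slack hmin hmax, ?_, by ext; simp [τ₀, hcolor]⟩
    rw [card_disjSum, card_empty, zero_add, card_erase_add_one (mem_univ a), card_univ]
  obtain ⟨σ, hσ, hodd⟩ : ∃ σ ∈ ℛ, Odd #{x ∈ σ | σ.erase x ∈ 𝒟} := by
    refine exists_odd_card_erase_mem hτ₀ ?_ fun τ h ↦ ?_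
    · rw [card_insert_mem hτ₀, card_extensions_slack_eq_one (hu a) hmin hmax]
      exact odd_one
    · obtain ⟨hne, hτ⟩ := mem_erase.1 h
      obtain ⟨hdom, hcard, himage⟩ := mem_filter_univ _ |>.1 hτ
      obtain ⟨t, ht⟩ := exists_inl_mem_of_image_eq_erase hcolor hcard himage hne
      rw [card_insert_mem hτ, hdom.card_extensions_eq_two hu ⟨_, ht⟩ hcard
        fun k ↦ ⟨.inr k, fun l hl ↦ ⟨_, ht, hmax l k hl.symm t⟩⟩]
      exact even_two
  obtain ⟨hdom, hcard⟩ := mem_filter_univ _ |>.1 hσ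
  rw [filter_congr fun x hx ↦ erase_mem_𝒟 hσ hx] at hodd
  exact ⟨σ, hdom, of_not_not fun hne ↦
    Nat.not_even_iff_odd.2 hodd (even_card_filter_image_erase hcard hne a)⟩

end Slack

theorem exists_dominating_pair [Finite T] [Finite J] [Nonempty J] [Nonempty T] (u : J → T → α)
    (color : T → J) : ∃ (A : Finset T) (C : Finset J),
      (∀ i ∈ C, ∃ t ∈ A, color t = i) ∧ ∀ t, ∃ i ∈ C, ∀ x ∈ A, u i t ≤ u i x := by
  classical
  have := Fintype.ofFinite J
  obtain ⟨n, ⟨e⟩⟩ := Finite.exists_equiv_fin (T ⊕ J)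
  let base (i : J) : T ⊕ J → WithBot (WithTop α) :=
    Sum.elim (fun t ↦ ((u i t : WithTop α) : WithBot (WithTop α)))
      (fun j ↦ if j = i then ⊥ else ((⊤ : WithTop α) : WithBot (WithTop α)))
  -- The second component breaks the ties of the first one.
  let v (i : J) (s : T ⊕ J) : WithBot (WithTop α) ×ₗ Fin n := toLex (base i s, e s)
  have hv : ∀ i, Function.Injective (v i) := fun i s s' h ↦
    e.injective (congrArg (fun z ↦ (ofLex z).2) h)
  have hlt {i s s'} (h : base i s < base i s') : v i s < v i s' :=
    Prod.Lex.toLex_lt_toLex.2 (.inl h)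
  obtain ⟨σ, hdom, himage⟩ := exists_isDominating_image_eq_univ
    (color := Sum.elim color id) hv (fun i t ↦ hlt (by simp [base]))
    (fun i j hj t ↦ hlt (by simpa [base, hj] using WithBot.coe_lt_coe.2 (WithTop.coe_lt_top _)))
    (fun j ↦ rfl)
  refine ⟨σ.toLeft, univ \ σ.toRight, fun i hi ↦ ?_, fun t ↦ ?_⟩
  · obtain ⟨t | j, hs, hsi⟩ := mem_image.1 (himage ▸ mem_univ i)
    · exact ⟨t, mem_toLeft.2 hs, hsi⟩
    · obtain rfl : j = i := hsi
      simp [hs] at hi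
  · obtain ⟨i, hi⟩ := hdom (.inl t)
    have hle : ∀ s ∈ σ, base i (.inl t) ≤ base i s := fun s hs ↦
      Prod.Lex.monotone_fst _ _ (hi s hs)
    refine ⟨i, ?_, fun x hx ↦ by simpa [base] using hle (.inl x) (mem_toLeft.1 hx)⟩
    simp only [mem_sdiff, mem_univ, true_and, mem_toRight]
    intro hmem
    simpa [base] using hle _ hmem

end Scarf

section Simplex

open Filter Topology

variable {J : Type*} [Fintype J]

theorem apply_le_add_of_one_sub_le_sum {m : J → ℝ} {ε : ℝ} {x : stdSimplex ℝ J}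
    (hm : ∀ i, m i ≤ x i) (hsum : 1 - ε ≤ ∑ i, m i) (i : J) : x i ≤ m i + ε := by
  have hle : x i - m i ≤ ∑ j, (x j - m j) :=
    single_le_sum (fun j _ ↦ sub_nonneg.2 (hm j)) (mem_univ i)
  rw [sum_sub_distrib, stdSimplex.sum_eq_one] at hle
  linarith

variable [Nonempty J]

theorem exists_stdSimplex_ge {w : J → ℝ} (h0 : 0 ≤ w) (h1 : ∑ i, w i ≤ 1) :
    ∃ z : stdSimplex ℝ J, ∀ i, w i ≤ z i := by
  classical
  obtain ⟨j⟩ := ‹Nonempty J›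
  have hle : w ≤ w + Pi.single j (1 - ∑ i, w i) :=
    le_add_of_nonneg_right (Pi.single_nonneg.2 (sub_nonneg.2 h1))
  exact ⟨⟨_, h0.trans hle, by simp [sum_add_distrib]⟩, hle⟩

theorem one_sub_le_sum_of_forall_exists_le {T : Set (stdSimplex ℝ J)} {w : J → ℝ} {δ : ℝ}
    (hδ : 0 ≤ δ) (hT : ∀ z, ∃ t ∈ T, dist z t < δ) (h0 : 0 ≤ w)
    (hw : ∀ t ∈ T, ∃ i, t i ≤ w i) : 1 - Fintype.card J * δ ≤ ∑ i, w i := by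
  by_contra! hlt
  obtain ⟨z, hz⟩ := exists_stdSimplex_ge (w := fun i ↦ w i + δ) (fun i ↦ add_nonneg (h0 i) hδ)
    (by simp only [sum_add_distrib, sum_const, card_univ, nsmul_eq_mul]; linarith)
  obtain ⟨t, ht, hzt⟩ := hT z
  obtain ⟨i, hi⟩ := hw t ht
  have hdist : z i - t i < δ :=
    (le_abs_self _).trans_lt ((dist_le_pi_dist (z : J → ℝ) t i).trans_lt hzt)
  linarith [hz i]

theorem exists_colored_corner (color : stdSimplex ℝ J → J) {ε : ℝ} (hε : 0 < ε) :
    ∃ (A : Set (stdSimplex ℝ J)) (m : J → ℝ), A.Nonempty ∧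
      (∀ x ∈ A, ∀ i, x i ∈ Set.Icc (m i) (m i + ε)) ∧ ∀ i, m i = 0 ∨ ∃ y ∈ A, color y = i := by
  classical
  have hδ : 0 < ε / Fintype.card J := by positivity
  obtain ⟨T, -, hfin, hcover⟩ := isCompact_univ.finite_cover_balls (X := stdSimplex ℝ J) hδ
  have hnet : ∀ z, ∃ t ∈ T, dist z t < ε / Fintype.card J := fun z ↦ by
    simpa using hcover (Set.mem_univ z)
  have : Finite T := hfin
  have : Nonempty T := let ⟨t, ht, _⟩ := hnet (Classical.arbitrary _); ⟨t, ht⟩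
  obtain ⟨A, C, hC, hdom⟩ := exists_dominating_pair (fun i (t : T) ↦ t.1 i) fun t ↦ color t
  have hA : A.Nonempty := by
    obtain ⟨i, hi, -⟩ := hdom (Classical.arbitrary T)
    exact (hC i hi).imp fun t ht ↦ ht.1
  choose μ hμ hμ_le using fun i ↦ A.exists_min_image (fun t : T ↦ t.1 i) hA
  let m (i : J) : ℝ := if i ∈ C then (μ i).1 i else 0
  have hm0 : 0 ≤ m := fun i ↦ by
    simp only [m]
    split_ifs
    exacts [(μ i).1.2.1 i, le_rfl]
  have m_le : ∀ t ∈ A, ∀ i, m i ≤ t.1 i := fun t ht i ↦ by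
    simp only [m]
    split_ifs
    exacts [hμ_le i t ht, t.1.2.1 i]
  have hsum : 1 - ε ≤ ∑ i, m i := by
    refine le_of_eq_of_le ?_ (one_sub_le_sum_of_forall_exists_le hδ.le hnet hm0 fun t ht ↦ ?_)
    · field_simp
    · obtain ⟨i, hi, hle⟩ := hdom ⟨t, ht⟩
      exact ⟨i, by simpa [m, hi] using hle _ (hμ i)⟩
  refine ⟨Subtype.val '' (A : Set T), m, hA.to_set.image _, ?_, fun i ↦ ?_⟩
  · rintro _ ⟨t, ht, rfl⟩ i
    exact ⟨m_le t ht i, apply_le_add_of_one_sub_le_sum (m_le t ht) hsum i⟩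
  · by_cases hi : i ∈ C
    · obtain ⟨y, hy, hyi⟩ := hC i hi
      exact .inr ⟨y, Set.mem_image_of_mem _ hy, hyi⟩
    · exact .inl (if_neg hi)

theorem exists_apply_le_or_color_dist_le (color : stdSimplex ℝ J → J) {ε : ℝ} (hε : 0 < ε) :
    ∃ x : stdSimplex ℝ J, ∀ i, x i ≤ ε ∨ ∃ y, color y = i ∧ dist y x ≤ ε := by
  obtain ⟨A, m, ⟨x, hx⟩, hcorner, hm⟩ := exists_colored_corner color hε
  refine ⟨x, fun i ↦ (hm i).imp (fun hi ↦ ?_) ?_⟩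
  · simpa [hi] using (hcorner x hx i).2
  · rintro ⟨y, hy, hyi⟩
    refine ⟨y, hyi, (dist_pi_le_iff hε.le).2 fun j ↦ ?_⟩
    exact (Real.dist_le_of_mem_Icc (hcorner y hy j) (hcorner x hx j)).trans_eq
      (add_sub_cancel_left _ _)

theorem exists_stdSimplex_mem_of_isClosed_cover {F : J → Set (stdSimplex ℝ J)}
    (hF : ∀ j, IsClosed (F j)) (hcover : ∀ x, ∃ j, x ∈ F j) :
    ∃ x : stdSimplex ℝ J, ∀ j, 0 < x j → x ∈ F j := by
  choose color hcolor using hcover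
  choose x hx using fun n : ℕ ↦
    exists_apply_le_or_color_dist_le color (ε := 1 / ((n : ℝ) + 1)) (by positivity)
  obtain ⟨a, φ, hφ, ha⟩ := CompactSpace.tendsto_subseq x
  have hε : Tendsto (fun n ↦ 1 / ((φ n : ℝ) + 1)) atTop (𝓝 0) :=
    tendsto_one_div_add_atTop_nhds_zero_nat.comp hφ.tendsto_atTop
  refine ⟨a, fun j hj ↦ (hF j).closure_subset_iff.2 subset_rfl (Metric.mem_closure_iff.2 ?_)⟩
  intro η hη
  have hcoord : Tendsto (fun n ↦ x (φ n) j) atTop (𝓝 (a j)) :=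
    (((continuous_apply j).comp continuous_subtype_val).tendsto a).comp ha
  obtain ⟨n, hn, hεn, han⟩ := ((hε.eventually_lt hcoord hj).and
    ((hε.eventually (gt_mem_nhds (half_pos hη))).and
      (ha.eventually (Metric.ball_mem_nhds a (half_pos hη))))).exists
  obtain hle | ⟨y, rfl, hy⟩ := hx (φ n) j
  · exact absurd hn hle.not_gt
  · refine ⟨y, hcolor y, ?_⟩
    calc dist a y ≤ dist a (x (φ n)) + dist y (x (φ n)) := dist_triangle_right _ _ _
      _ < η / 2 + η / 2 := add_lt_add (Metric.mem_ball'.1 han) (hy.trans_lt hεn)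
      _ = η := add_halves η

end Simplex

section Marginals

variable {I : Type*} {K : I → Type*} [Fintype I] [DecidableEq I] [∀ i, Fintype (K i)]

/-- The marginals of a probability vector on a product of finite types, used to pass from one
simplex to a product of simplices. -/
noncomputable def marginals (y : stdSimplex ℝ (∀ i, K i)) (i : I) : stdSimplex ℝ (K i) :=
  stdSimplex.map (fun j ↦ j i) y

theorem continuous_marginals : Continuous (marginals (K := K)) := by
  refine continuous_pi fun i ↦ ?_
  exact stdSimplex.continuous_map _

theorem exists_apply_pos_of_marginals_pos {y : stdSimplex ℝ (∀ i, K i)} {i : I} {k : K i}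
    (hk : 0 < marginals y i k) : ∃ j : ∀ i, K i, j i = k ∧ 0 < y j := by
  classical
  rw [marginals, stdSimplex.map_coe, FunOnFinite.linearMap_apply_apply] at hk
  obtain ⟨j, hj, hpos⟩ := exists_lt_of_sum_lt (f := fun _ ↦ 0) (sum_const_zero.trans_lt hk)
  exact ⟨j, (mem_filter.1 hj).2, hpos⟩

end Marginals

theorem exists_pi_stdSimplex_mem_of_isClosed_cover {I : Type*} {K : I → Type*} [Finite I]
    [∀ i, Fintype (K i)] [∀ i, Nonempty (K i)] {F : ∀ i, K i → Set (∀ i, stdSimplex ℝ (K i))}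
    (hF : ∀ i k, IsClosed (F i k)) (hcover : ∀ x i, ∃ k, x ∈ F i k) :
    ∃ x : ∀ i, stdSimplex ℝ (K i), ∀ i k, 0 < x i k → x ∈ F i k := by
  classical
  have := Fintype.ofFinite I
  have hclosed : ∀ j : ∀ i, K i, IsClosed (marginals ⁻¹' ⋂ i, F i (j i)) := fun j ↦
    (isClosed_iInter fun i ↦ hF i (j i)).preimage continuous_marginals
  have hcover' : ∀ y, ∃ j : ∀ i, K i, y ∈ marginals ⁻¹' ⋂ i, F i (j i) := fun y ↦ by
    choose j hj using hcover (marginals y)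
    exact ⟨j, Set.mem_iInter.2 hj⟩
  obtain ⟨y, hy⟩ := exists_stdSimplex_mem_of_isClosed_cover hclosed hcover'
  refine ⟨marginals y, fun i k hk ↦ ?_⟩
  obtain ⟨j, rfl, hj⟩ := exists_apply_pos_of_marginals_pos hk
  exact Set.mem_iInter.1 (hy j hj) i

theorem isClosed_setOf_le_of_semicontinuous {X γ : Type*} [TopologicalSpace X] [LinearOrder γ]
    [DenselyOrdered γ] {f g : X → γ} (hf : LowerSemicontinuous f) (hg : UpperSemicontinuous g) :
    IsClosed {x | f x ≤ g x} := by
  refine isOpen_compl_iff.1 (isOpen_iff_mem_nhds.2 fun x hx ↦ ?_)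
  obtain ⟨b, hgb, hbf⟩ := exists_between (not_le.1 hx)
  filter_upwards [hf x b hbf, hg x b hgb] with y hfy hgy
  exact (hgy.trans hfy).not_ge

namespace RoutingNetwork

variable {V E I : Type*}

section Flow

variable (N : RoutingNetwork V E I)

/-- The flow that splits the demand of every commodity `i` among its paths in the proportions `x i`,
a parametrization of the demand-feasible flows by a product of simplices. -/
def splitFlow (x : ∀ i, stdSimplex ℝ {p // p ∈ N.P i}) : N.demandFeasible :=
  ⟨fun z ↦ N.Q z.1 * x z.1 z.2,
    fun z ↦ mul_nonneg (N.Q z.1).2 ((x z.1).2.1 z.2),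
    fun i ↦ calc
      ∑ p, (N.Q i : ℝ) * x i p = N.Q i * ∑ p, x i p := (mul_sum _ _ _).symm
      _ = N.Q i := by rw [stdSimplex.sum_eq_one, mul_one]⟩

theorem continuous_splitFlow : Continuous N.splitFlow := by
  refine Continuous.subtype_mk (continuous_pi fun z ↦ continuous_const.mul ?_) _
  exact (continuous_apply z.2).comp (continuous_subtype_val.comp (continuous_apply z.1))

theorem exists_flow_mem_of_isClosed_cover [Finite I]
    {F : ∀ i, {p // p ∈ N.P i} → Set N.demandFeasible} (hF : ∀ i p, IsClosed (F i p))
    (hcover : ∀ f i, ∃ p, f ∈ F i p) :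
    ∃ f : N.demandFeasible, ∀ i p, 0 < f.1 ⟨i, p⟩ → f ∈ F i p := by
  have (i : I) : Nonempty {p // p ∈ N.P i} := (N.nonempty_P i).to_subtype
  obtain ⟨x, hx⟩ := exists_pi_stdSimplex_mem_of_isClosed_cover
    (fun i p ↦ (hF i p).preimage N.continuous_splitFlow) fun x ↦ hcover (N.splitFlow x)
  exact ⟨N.splitFlow x, fun i p hp ↦ hx i p (pos_of_mul_pos_right hp (N.Q i).2)⟩

end Flow

namespace CostStructure

variable [Fintype I] {N : RoutingNetwork V E I} {c : N.CostStructure}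

theorem le_upperHull (i : I) (e : E) (f : N.demandFeasible) :
    (c f i e : ℝ≥0∞) ≤ c.upperHull i e f :=
  le_iInf₂ fun ε hε ↦ le_iSup₂ (f := fun x (_ : x ∈ Metric.ball f ε) ↦ (c x i e : ℝ≥0∞)) f
    (Metric.mem_ball_self hε)

theorem upperSemicontinuous_upperHull (i : I) (e : E) :
    UpperSemicontinuous (c.upperHull i e) := by
  intro f b hb
  simp only [upperHull, iInf_lt_iff] at hb
  obtain ⟨ε, hε, hlt⟩ := hb
  filter_upwards [Metric.ball_mem_nhds f (half_pos hε)] with g hg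
  refine (iInf₂_le_of_le (ε / 2) (half_pos hε) ?_).trans_lt hlt
  refine biSup_mono fun x hx ↦ Metric.ball_subset_ball' ?_ hx
  linarith [Metric.mem_ball.1 hg]

variable [DecidableEq E]

theorem sum_sdiff_le_sum_upperHull_sdiff (hlsc : c.IsLowerSemicontinuous) {i : I}
    {p q : {p // p ∈ N.P i}} {f : N.demandFeasible}
    (hf : f ∈ closure {g | c.pathCost i p g ≤ c.pathCost i q g}) :
    ∑ e ∈ p.1.toFinset \ q.1.toFinset, (c f i e : ℝ≥0∞) ≤
      ∑ e ∈ q.1.toFinset \ p.1.toFinset, c.upperHull i e f := by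
  have hlower : LowerSemicontinuous fun g ↦
      ∑ e ∈ p.1.toFinset \ q.1.toFinset, (c g i e : ℝ≥0∞) :=
    lowerSemicontinuous_sum fun e _ ↦
      ENNReal.continuous_coe.comp_lowerSemicontinuous (hlsc i e) ENNReal.coe_mono
  have hupper : UpperSemicontinuous fun g ↦
      ∑ e ∈ q.1.toFinset \ p.1.toFinset, c.upperHull i e g :=
    upperSemicontinuous_sum fun e _ ↦ upperSemicontinuous_upperHull i e
  refine closure_minimal (fun g hg ↦ ?_) (isClosed_setOf_le_of_semicontinuous hlower hupper) hf
  calc ∑ e ∈ p.1.toFinset \ q.1.toFinset, (c g i e : ℝ≥0∞)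
      ≤ ∑ e ∈ q.1.toFinset \ p.1.toFinset, (c g i e : ℝ≥0∞) := by
        exact_mod_cast sum_sdiff_le_sum_sdiff.2 hg
    _ ≤ ∑ e ∈ q.1.toFinset \ p.1.toFinset, c.upperHull i e g :=
        sum_le_sum fun e _ ↦ le_upperHull i e g

theorem pathCost_le_hullCost_of_mem_closure (hlsc : c.IsLowerSemicontinuous) {i : I}
    {p q : {p // p ∈ N.P i}} {f : N.demandFeasible}
    (hf : f ∈ closure {g | c.pathCost i p g ≤ c.pathCost i q g}) :
    (c.pathCost i p f : ℝ≥0∞) ≤ c.hullCost i p q f := by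
  rw [pathCost, hullCost, ENNReal.ofNNReal_finsetSum, ← sum_inter_add_sum_sdiff _ q.1.toFinset]
  gcongr
  exact sum_sdiff_le_sum_upperHull_sdiff hlsc hf

theorem exists_pathCost_le_hullCost (hlsc : c.IsLowerSemicontinuous) :
    ∃ f : N.demandFeasible, ∀ i p, 0 < f.1 ⟨i, p⟩ →
      (c.pathCost i p f : ℝ≥0∞) ≤ ⨅ q, c.hullCost i p q f := by
  have (i : I) : Nonempty {p // p ∈ N.P i} := (N.nonempty_P i).to_subtype
  obtain ⟨f, hf⟩ := N.exists_flow_mem_of_isClosed_cover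
    (F := fun i p ↦ closure {g | ∀ q, c.pathCost i p g ≤ c.pathCost i q g})
    (fun i p ↦ isClosed_closure) fun g i ↦
      (Finite.exists_min fun p ↦ c.pathCost i p g).imp fun p hp ↦ subset_closure hp
  refine ⟨f, fun i p hp ↦ le_iInf fun q ↦ pathCost_le_hullCost_of_mem_closure hlsc ?_⟩
  exact closure_mono (Set.ofPred_subset_ofPred.2 fun g hg ↦ hg q) (hf i p hp)

end CostStructure

end RoutingNetwork

theorem theorem10_general {V E I : Type*} [DecidableEq E] [Fintype I] [DecidableEq I]
    (N : RoutingNetwork V E I) (c : N.CostStructure)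
    (hlsc : c.IsLowerSemicontinuous) (hreg : c.WeaklyRegular) :
    ∃ f : N.demandFeasible, c.IsBSEquilibrium f := by
  obtain ⟨f, hf⟩ := RoutingNetwork.CostStructure.exists_pathCost_le_hullCost hlsc
  exact ⟨f, fun i p hp ↦ le_iInf_iff.1 (hreg f i p hp (hf i p hp))⟩

theorem theorem10 {V E I : Type*} [DecidableEq E] [Fintype I] [DecidableEq I]
    (N : RoutingNetwork V E I) (c : N.CostStructure)
    (hlsc : c.IsLowerSemicontinuous) (hbdd : c.IsBounded) (hreg : c.WeaklyRegular) :
    ∃ f : N.demandFeasible, c.IsBSEquilibrium f :=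
  theorem10_general N c hlsc hreg
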